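/- Let $S^1=\mathbb R/2\pi\mathbb Z$, $z=e^{i\theta}$, and let $w\in W^{1,\infty}(S^1)$ be real-valued with $0<w_-\le w\le w_+<\infty$ a.e. Let $L^2(w)=L^2(S^1,w\,\frac{d\theta}{2\pi})$ with inner product $\langle f,g\rangle_w=\int f\overline g\,w\,\frac{d\theta}{2\pi}$, and for $\lambda>0$ and $f,g\in H^1(S^1)$ put $$\langle f,g\rangle_{w,\lambda}=\int f\overline g\,w\,\frac{d\theta}{2\pi}+\lambda\int f'\,\overline{g'}\,\frac{d\theta}{2\pi}.$$ For $N\in\mathbb N=\{0,1,2,\dots\}$ let $\mathcal A_{\le N}=\mathrm{span}\{1,z,\dots,z^N\}$, and let $(\varphi^{(0)}_k)_{k=0}^N$ and $(\varphi^{(\lambda)}_k)_{k=0}^N$ be the orthonormal polynomials obtained from $(1,z,\dots,z^N)$ by Gram–Schmidt with respect to $\langle\cdot,\cdot\rangle_w$ and $\langle\cdot,\cdot\rangle_{w,\lambda}$ respectively. Let $P^{(0)}$ be the orthogonal projector of $L^2(w)$ onto $\mathcal A_{\le N}$, and let $P^{(\lambda)}$ be the orthogonal projector onto $\mathcal A_{\le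 N}$ for the Sobolev geometry, i.e. the bounded operator on $L^2(w)$ with values in $\mathcal A_{\le N}$ such that $\langle f-P^{(\lambda)}f,g\rangle_{w,\lambda}=0$ for all $f\in H^1(S^1)$, $g\in\mathcal A_{\le N}$. Put $C_N(w)=N^4\,(w_-^{-2}w_++w_-^{-1})$. There is an absolute constant $K>0$ such that for all such $w,w_-,w_+$ and all $N$ there is a constant $\widetilde C_N(w)\ge 0$ with $\widetilde C_N(w)\le K\,C_N(w)$, and $\widetilde C_N(w)>0$ if $N\ge1$, for which the following holds. 1. For every $\lambda>0$ the operator $P^{(\lambda)}$ exists, is unique, and satisfies $\|P^{(\lambda)}-P^{(0)}\|_{\mathcal B(L^2(w))}\le\widetilde C_N(w)\,\lambda$. 2. There is a unitary matrix $U_N\in U(N+1)$ such that for every $\lambda>0$ $$\max_{0\le k\le N}\Big\|\varphi^{(\lambda)}_k-\sum_{j=0}^N(U_N)_{kj}\,\varphi^{(0)}_j\Big\|_{L^2(w)}\le\widetilde C_N(w)\,\lambda.$$ -/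

import Mathlib

open MeasureTheory AddCircle
open scoped ComplexConjugate ContDiff

noncomputable section

namespace SobolevOPUC

instance twoPiPos : Fact (0 < 2 * Real.pi) := ⟨Real.two_pi_pos⟩

/-- The unit circle, parametrised by the angle `θ ∈ ℝ / 2πℤ`. Its measure `haarAddCircle` is the
normalised measure `dθ / 2π`, and `fourier n` is the function `z ^ n = exp (i n θ)`. -/
abbrev S1 : Type := AddCircle (2 * Real.pi)

/-- The classical derivative `∂_θ φ`. -/
def angleDeriv (φ : S1 → ℂ) (x : S1) : ℂ :=
  deriv (fun t : ℝ => φ (x + (t : S1))) 0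

/-- `φ` is a smooth function on the circle. -/
def IsTestFunction (φ : S1 → ℂ) : Prop :=
  ContDiff ℝ ∞ (fun t : ℝ => φ (t : S1))

/-- `g` is a weak derivative of `f` on the circle (for `f` and `g` integrable). -/
def HasWeakDeriv (f g : S1 → ℂ) : Prop :=
  ∀ φ : S1 → ℂ, IsTestFunction φ →
    ∫ x, f x * angleDeriv φ x ∂haarAddCircle = -∫ x, g x * φ x ∂haarAddCircle

/-- `w ∈ W^{1,∞}(S¹)`, for real-valued `w`. -/
def MemW1Inf (w : S1 → ℝ) : Prop :=
  MemLp w ⊤ haarAddCircle ∧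
    ∃ w' : S1 → ℝ, MemLp w' ⊤ haarAddCircle ∧
      HasWeakDeriv (fun x => (w x : ℂ)) (fun x => (w' x : ℂ))

/-- `f ∈ H¹(S¹)`. -/
def MemH1 (f : S1 → ℂ) : Prop :=
  MemLp f 2 haarAddCircle ∧ ∃ g : S1 → ℂ, MemLp g 2 haarAddCircle ∧ HasWeakDeriv f g

open Classical in
/-- The weak derivative of a function in `H¹(S¹)` (determined almost everywhere), and `0` for
functions that are not in `H¹(S¹)`. -/
def weakDeriv (f : S1 → ℂ) : S1 → ℂ :=
  if h : MemH1 f then h.2.choose else 0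

/-- A weight `w ∈ W^{1,∞}(S¹)` together with constants `0 < w₋ ≤ w ≤ w₊ < ∞`. -/
structure Weight where
  /-- the density -/
  w : S1 → ℝ
  /-- the lower bound `w₋` -/
  lower : ℝ
  /-- the upper bound `w₊` -/
  upper : ℝ
  memW1Inf : MemW1Inf w
  lower_pos : 0 < lower
  lower_le : ∀ᵐ x ∂haarAddCircle, lower ≤ w x
  le_upper : ∀ᵐ x ∂haarAddCircle, w x ≤ upper

/-- The measure `dμ = w dθ / 2π`. -/
def Weight.measure (W : Weight) : Measure S1 :=
  haarAddCircle.withDensity (fun x => ENNReal.ofReal (W.w x))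

instance (W : Weight) : IsFiniteMeasure W.measure :=
  isFiniteMeasure_withDensity_ofReal (W.memW1Inf.1.integrable le_top).2

/-- The Hilbert space `L²(w) = L²(S¹, w dθ / 2π)`. Mathlib's `inner ℂ g f` on it is
`⟨f, g⟩_w = ∫ f * conj g * w dθ / 2π`. -/
abbrev L2 (W : Weight) : Type := Lp ℂ 2 W.measure

/-- The monomial `z ^ k` as an element of `L²(w)`. -/
def monomial (W : Weight) (k : ℕ) : L2 W :=
  ContinuousMap.toLp 2 W.measure ℂ (fourier (k : ℤ))

/-- The space `span {1, z, …, z ^ N}`. -/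
def analyticModes (W : Weight) (N : ℕ) : Submodule ℂ (L2 W) :=
  Submodule.span ℂ ((fun k : ℕ => monomial W k) '' Set.Iic N)

instance (W : Weight) (N : ℕ) : FiniteDimensional ℂ (analyticModes W N) :=
  FiniteDimensional.span_of_finite ℂ ((Set.finite_Iic N).image _)

/-- The mixed Sobolev inner product
`⟨f, g⟩_{w,lam} = ∫ f * conj g * w dθ / 2π + lam * ∫ f' * conj g' dθ / 2π` (for `f, g` in `H¹`). -/
def sobolevInner (W : Weight) (lam : ℝ) (f g : L2 W) : ℂ :=
  ∫ x, f x * conj (g x) * (W.w x : ℂ) ∂haarAddCircle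
    + (lam : ℂ) * ∫ x, weakDeriv f x * conj (weakDeriv g x) ∂haarAddCircle

/-- Gram–Schmidt orthogonalisation of the sequence `v` for the sesquilinear form `B` (linear in
its first argument), without normalisation. -/
def gramSchmidtForm {V : Type*} [AddCommGroup V] [Module ℂ V] (B : V → V → ℂ) (v : ℕ → V) :
    ℕ → V
  | k => v k - ∑ i : Fin k,
      (B (v k) (gramSchmidtForm B v i) / B (gramSchmidtForm B v i) (gramSchmidtForm B v i)) •
        gramSchmidtForm B v i
decreasing_by all_goals exact i.isLt

/-- Gram–Schmidt orthonormalisation of the sequence `v` for the sesquilinear form `B`. -/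
def gramSchmidtFormNormed {V : Type*} [AddCommGroup V] [Module ℂ V] (B : V → V → ℂ) (v : ℕ → V)
    (k : ℕ) : V :=
  ((Real.sqrt (B (gramSchmidtForm B v k) (gramSchmidtForm B v k)).re : ℂ))⁻¹ •
    gramSchmidtForm B v k

/-- The orthonormal polynomials `φ_k^{(0)}` of `⟨·,·⟩_w`. -/
def opuc (W : Weight) (k : ℕ) : L2 W :=
  InnerProductSpace.gramSchmidtNormed ℂ (monomial W) k

/-- The orthonormal polynomials `φ_k^{(lam)}` of `⟨·,·⟩_{w,lam}`. -/
def sobolevOpuc (W : Weight) (lam : ℝ) (k : ℕ) : L2 W :=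
  gramSchmidtFormNormed (sobolevInner W lam) (monomial W) k

/-- `P`, a bounded operator on `L²(w)`, is the orthogonal projector onto `span {1, z, …, z ^ N}`
for the Sobolev geometry: it takes values in that space, and for every `f ∈ H¹(S¹)` the difference
`f - P f` is `⟨·,·⟩_{w,lam}`-orthogonal to it. (By density of `H¹(S¹)` in `L²(w)` there is only one
such `P`.) -/
def IsSobolevProjector (W : Weight) (lam : ℝ) (N : ℕ) (P : L2 W →L[ℂ] L2 W) : Prop :=
  (∀ f : L2 W, P f ∈ analyticModes W N) ∧
    ∀ f : L2 W, MemH1 f → ∀ g ∈ analyticModes W N, sobolevInner W lam (f - P f) g = 0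

/-- The explicit constant `C_N(w) = N⁴ (w₋⁻² w₊ + w₋⁻¹)`. -/
def finiteDegreeConst (W : Weight) (N : ℕ) : ℝ :=
  (N : ℝ) ^ 4 * (W.upper / W.lower ^ 2 + 1 / W.lower)

end SobolevOPUC

end

/-!
The Sobolev form is the inner product of `L²(w) × ℂᵐ` pulled back along the graph embedding
`f ↦ (f, T f)`, where `T` is `√λ` times the derivative, truncated to the frequencies that occur in
`𝒜_{≤ N}`. Since `w ≥ w₋`, Bessel's inequality gives `‖T‖² ≤ λ N² / w₋`.

Let `V` be finite-dimensional, let `h` be orthogonal to `V` in `L²(w)`, and let `r ∈ V` be such that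
`h - r` is orthogonal to `V` for the Sobolev form. Testing with `r` itself gives
`‖r‖² + ‖T r‖² = ⟨T h, T r⟩`, hence `‖r‖ ≤ ‖T‖² ‖h‖`. For `h = f - P⁽⁰⁾ f` the correction `r` is
`P⁽λ⁾ f - P⁽⁰⁾ f`. For `V = span {1, …, z ^ (k - 1)}` it is the difference of the two `k`-th
Gram–Schmidt vectors, whose normalising factors differ by at most the same relative error; so no
rotation of the basis is needed and `U_N = 1`.
-/

noncomputable section

namespace SobolevOPUC

open InnerProductSpace

section GraphEmbedding

variable {𝕜 E F : Type*} [RCLike 𝕜] [NormedAddCommGroup E] [InnerProductSpace 𝕜 E]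
  [NormedAddCommGroup F] [InnerProductSpace 𝕜 F]

/-- The embedding `f ↦ (f, T f)` of `E` onto the graph of `T`. It is isometric for the graph inner
product `⟪f, g⟫ + ⟪T f, T g⟫`; a factor `√λ` in front of a derivative is absorbed into `T`. -/
def graphEmbedding (T : E →L[𝕜] F) : E →L[𝕜] WithLp 2 (E × F) :=
  (WithLp.prodContinuousLinearEquiv 2 𝕜 E F).symm.toContinuousLinearMap ∘L
    (ContinuousLinearMap.id 𝕜 E).prod T

lemma inner_graphEmbedding (T : E →L[𝕜] F) (f g : E) :
    inner 𝕜 (graphEmbedding T f) (graphEmbedding T g) = inner 𝕜 f g + inner 𝕜 (T f) (T g) := by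
  rw [WithLp.prod_inner_apply]
  rfl

lemma norm_sq_graphEmbedding (T : E →L[𝕜] F) (f : E) :
    ‖graphEmbedding T f‖ ^ 2 = ‖f‖ ^ 2 + ‖T f‖ ^ 2 := by
  rw [WithLp.prod_norm_sq_eq_of_L2]
  rfl

lemma norm_le_norm_graphEmbedding (T : E →L[𝕜] F) (f : E) : ‖f‖ ≤ ‖graphEmbedding T f‖ := by
  refine le_of_sq_le_sq ?_ (norm_nonneg _)
  rw [norm_sq_graphEmbedding]
  exact le_add_of_nonneg_right (sq_nonneg _)

lemma graphEmbedding_injective (T : E →L[𝕜] F) : Function.Injective (graphEmbedding T) :=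
  fun _ _ h => congrArg WithLp.fst h

lemma norm_graphEmbedding_le (T : E →L[𝕜] F) (f : E) :
    ‖graphEmbedding T f‖ ≤ (1 + ‖T‖ ^ 2) * ‖f‖ := by
  refine le_of_sq_le_sq ?_ (by positivity)
  calc ‖graphEmbedding T f‖ ^ 2 = ‖f‖ ^ 2 + ‖T f‖ ^ 2 := norm_sq_graphEmbedding T f
    _ ≤ ‖f‖ ^ 2 + (‖T‖ * ‖f‖) ^ 2 := by gcongr; exact T.le_opNorm f
    _ = (1 + ‖T‖ ^ 2) * ‖f‖ ^ 2 := by ring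
    _ ≤ (1 + ‖T‖ ^ 2) ^ 2 * ‖f‖ ^ 2 := by
      gcongr
      exact le_self_pow₀ (le_add_of_nonneg_right (sq_nonneg _)) two_ne_zero
    _ = ((1 + ‖T‖ ^ 2) * ‖f‖) ^ 2 := by ring

lemma norm_le_opNorm_sq_mul_norm_of_orthogonal (T : E →L[𝕜] F) {r h : E}
    (hr : inner 𝕜 r h = 0)
    (hrT : inner 𝕜 (graphEmbedding T r) (graphEmbedding T (h - r)) = 0) :
    ‖r‖ ≤ ‖T‖ ^ 2 * ‖h‖ := by
  have hself : inner 𝕜 (graphEmbedding T r) (graphEmbedding T r) = inner 𝕜 (T r) (T h) := by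
    rw [map_sub, inner_sub_right, sub_eq_zero] at hrT
    rw [← hrT, inner_graphEmbedding, hr, zero_add]
  have hsq : ‖r‖ * ‖r‖ ≤ ‖r‖ * (‖T‖ ^ 2 * ‖h‖) :=
    calc ‖r‖ * ‖r‖ ≤ ‖graphEmbedding T r‖ * ‖graphEmbedding T r‖ :=
          mul_self_le_mul_self (norm_nonneg r) (norm_le_norm_graphEmbedding T r)
      _ = ‖inner 𝕜 (T r) (T h)‖ := by
        rw [← hself, ← inner_self_re_eq_norm, inner_self_eq_norm_mul_norm]
      _ ≤ ‖T r‖ * ‖T h‖ := norm_inner_le_norm _ _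
      _ ≤ (‖T‖ * ‖r‖) * (‖T‖ * ‖h‖) := by gcongr <;> exact T.le_opNorm _
      _ = ‖r‖ * (‖T‖ ^ 2 * ‖h‖) := by ring
  rcases (norm_nonneg r).eq_or_lt with hr0 | hr0
  · rw [← hr0]
    positivity
  · exact le_of_mul_le_mul_left hsq hr0

end GraphEmbedding

section PullbackProjection

variable {𝕜 E F G : Type*} [RCLike 𝕜] [NormedAddCommGroup E] [InnerProductSpace 𝕜 E]
  [NormedAddCommGroup F] [InnerProductSpace 𝕜 F] [NormedAddCommGroup G] [InnerProductSpace 𝕜 G]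

/-- The projection onto `V` that is orthogonal for the inner product of `G` pulled back along the
injective map `A`. -/
def pullbackProjection (A : E →L[𝕜] G) (hA : Function.Injective A) (V : Submodule 𝕜 E)
    [FiniteDimensional 𝕜 V] : E →L[𝕜] E :=
  V.subtypeL ∘L
    (Submodule.equivMapOfInjective A.toLinearMap hA V).symm.toContinuousLinearEquiv ∘L
    (V.map A.toLinearMap).orthogonalProjectionOnto ∘L A

lemma pullbackProjection_mem (A : E →L[𝕜] G) (hA : Function.Injective A) (V : Submodule 𝕜 E)
    [FiniteDimensional 𝕜 V] (f : E) : pullbackProjection A hA V f ∈ V :=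
  Subtype.property _

lemma map_pullbackProjection (A : E →L[𝕜] G) (hA : Function.Injective A) (V : Submodule 𝕜 E)
    [FiniteDimensional 𝕜 V] (f : E) :
    A (pullbackProjection A hA V f) = (V.map A.toLinearMap).starProjection (A f) :=
  congrArg Subtype.val ((Submodule.equivMapOfInjective A.toLinearMap hA V).apply_symm_apply
    ((V.map A.toLinearMap).orthogonalProjectionOnto (A f)))

lemma eq_pullbackProjection_iff (A : E →L[𝕜] G) (hA : Function.Injective A) (V : Submodule 𝕜 E)
    [FiniteDimensional 𝕜 V] {f x : E} :
    x = pullbackProjection A hA V f ↔ x ∈ V ∧ ∀ g ∈ V, inner 𝕜 (A g) (A (f - x)) = 0 := by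
  constructor
  · rintro rfl
    refine ⟨pullbackProjection_mem A hA V f, fun g hg => ?_⟩
    rw [map_sub, map_pullbackProjection]
    exact (V.map A.toLinearMap).sub_starProjection_mem_orthogonal (A f) _
      (Submodule.mem_map_of_mem (f := A.toLinearMap) hg)
  · rintro ⟨hxV, horth⟩
    apply hA
    rw [map_pullbackProjection]
    refine (Submodule.eq_starProjection_of_mem_orthogonal
      (Submodule.mem_map_of_mem (f := A.toLinearMap) hxV) ?_).symm
    rw [Submodule.mem_orthogonal]
    rintro _ ⟨g, hg, rfl⟩
    exact map_sub A f x ▸ horth g hg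

lemma norm_pullbackProjection_graphEmbedding_sub_starProjection_le (T : E →L[𝕜] F)
    (V : Submodule 𝕜 E) [FiniteDimensional 𝕜 V] :
    ‖pullbackProjection (graphEmbedding T) (graphEmbedding_injective T) V - V.starProjection‖
      ≤ ‖T‖ ^ 2 := by
  refine ContinuousLinearMap.opNorm_le_bound _ (sq_nonneg _) fun f => ?_
  set P := pullbackProjection (graphEmbedding T) (graphEmbedding_injective T) V
  obtain ⟨hmem, horth⟩ := (eq_pullbackProjection_iff _ (graphEmbedding_injective T) V).1
    (rfl : P f = _)
  have hV : P f - V.starProjection f ∈ V := V.sub_mem hmem (V.starProjection_apply_mem f)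
  calc ‖P f - V.starProjection f‖ ≤ ‖T‖ ^ 2 * ‖f - V.starProjection f‖ := by
        refine norm_le_opNorm_sq_mul_norm_of_orthogonal T
          (V.sub_starProjection_mem_orthogonal f _ hV) ?_
        rw [sub_sub_sub_cancel_right]
        exact horth _ hV
    _ ≤ ‖T‖ ^ 2 * ‖f‖ := by
        rw [← Submodule.starProjection_orthogonal_val]
        gcongr
        exact Vᗮ.norm_starProjection_apply_le f

end PullbackProjection

section GramSchmidt

lemma norm_inv_smul_sub_inv_norm_smul_le {𝕜 E : Type*} [RCLike 𝕜] [NormedAddCommGroup E]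
    [NormedSpace 𝕜 E] {x y : E} {t S : ℝ} (ht : 0 ≤ t) (hxy : ‖x - y‖ ≤ t * ‖y‖)
    (hyS : ‖y‖ ≤ S) (hSy : S ≤ (1 + t) * ‖y‖) :
    ‖(S : 𝕜)⁻¹ • x - (‖y‖ : 𝕜)⁻¹ • y‖ ≤ 2 * t := by
  rcases (norm_nonneg y).eq_or_lt with hy | hy
  · have hx : x = 0 := by simpa [norm_eq_zero.1 hy.symm] using hxy
    simpa [hx, norm_eq_zero.1 hy.symm] using ht
  have hS : 0 < S := hy.trans_le hyS
  have hsplit : (S : 𝕜)⁻¹ • x - (‖y‖ : 𝕜)⁻¹ • y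
      = (S : 𝕜)⁻¹ • ((x - y) + ((‖y‖ - S : ℝ) : 𝕜) • (‖y‖ : 𝕜)⁻¹ • y) := by
    have : (‖y‖ : 𝕜) ≠ 0 := RCLike.ofReal_ne_zero.2 hy.ne'
    have : (S : 𝕜) ≠ 0 := RCLike.ofReal_ne_zero.2 hS.ne'
    match_scalars <;> field_simp
    ring
  have hunit : ‖((‖y‖ - S : ℝ) : 𝕜) • (‖y‖ : 𝕜)⁻¹ • y‖ = S - ‖y‖ := by
    rw [norm_smul, norm_smul, norm_inv, RCLike.norm_ofReal, RCLike.norm_ofReal, abs_norm,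
      inv_mul_cancel₀ hy.ne', mul_one, abs_sub_comm, abs_of_nonneg (sub_nonneg.2 hyS)]
  calc ‖(S : 𝕜)⁻¹ • x - (‖y‖ : 𝕜)⁻¹ • y‖
      = S⁻¹ * ‖(x - y) + ((‖y‖ - S : ℝ) : 𝕜) • (‖y‖ : 𝕜)⁻¹ • y‖ := by
        rw [hsplit, norm_smul, norm_inv, RCLike.norm_ofReal, abs_of_pos hS]
    _ ≤ S⁻¹ * (t * ‖y‖ + t * ‖y‖) := by
        gcongr
        refine (norm_add_le _ _).trans (add_le_add hxy ?_)
        rw [hunit]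
        linarith
    _ ≤ S⁻¹ * (t * S + t * S) := by gcongr
    _ = 2 * t := by field_simp; ring

lemma norm_le_norm_add_of_inner_eq_zero {𝕜 E : Type*} [RCLike 𝕜] [NormedAddCommGroup E]
    [InnerProductSpace 𝕜 E] {x y : E} (h : inner 𝕜 x y = 0) : ‖y‖ ≤ ‖x + y‖ := by
  rw [mul_self_le_mul_self_iff (norm_nonneg _) (norm_nonneg _),
    norm_add_sq_eq_norm_sq_add_norm_sq_of_inner_eq_zero x y h]
  exact le_add_of_nonneg_left (mul_self_nonneg _)

lemma gramSchmidtForm_mem {V : Type*} [AddCommGroup V] [Module ℂ V] (B : V → V → ℂ) {v : ℕ → V}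
    {S : Submodule ℂ V} {k : ℕ} (hv : ∀ i ≤ k, v i ∈ S) : gramSchmidtForm B v k ∈ S := by
  induction k using Nat.strong_induction_on with
  | _ k ih =>
    rw [gramSchmidtForm]
    exact S.sub_mem (hv k le_rfl) <| S.sum_mem fun i _ => S.smul_mem _ <|
      ih i i.isLt fun j hj => hv j (hj.trans i.isLt.le)

lemma sub_gramSchmidtForm_mem_span {V : Type*} [AddCommGroup V] [Module ℂ V] (B : V → V → ℂ)
    (v : ℕ → V) (k : ℕ) : v k - gramSchmidtForm B v k ∈ Submodule.span ℂ (v '' Set.Iio k) := by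
  rw [gramSchmidtForm, sub_sub_cancel]
  exact Submodule.sum_mem _ fun i _ => Submodule.smul_mem _ _ <| gramSchmidtForm_mem B fun j hj =>
    Submodule.subset_span ⟨j, hj.trans_lt i.isLt, rfl⟩

lemma gramSchmidtForm_congr {V : Type*} [AddCommGroup V] [Module ℂ V] {B B' : V → V → ℂ}
    {v : ℕ → V} {S : Submodule ℂ V} (hB : ∀ f ∈ S, ∀ g ∈ S, B f g = B' f g) {k : ℕ}
    (hv : ∀ i ≤ k, v i ∈ S) : gramSchmidtForm B v k = gramSchmidtForm B' v k := by
  induction k using Nat.strong_induction_on with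
  | _ k ih =>
    rw [gramSchmidtForm, gramSchmidtForm]
    congr 1
    refine Finset.sum_congr rfl fun i _ => ?_
    have hvi : ∀ j ≤ (i : ℕ), v j ∈ S := fun j hj => hv j (hj.trans i.isLt.le)
    have hi : gramSchmidtForm B' v i ∈ S := gramSchmidtForm_mem B' hvi
    rw [ih i i.isLt hvi, hB _ (hv k le_rfl) _ hi, hB _ hi _ hi]

lemma gramSchmidtFormNormed_congr {V : Type*} [AddCommGroup V] [Module ℂ V] {B B' : V → V → ℂ}
    {v : ℕ → V} {S : Submodule ℂ V} (hB : ∀ f ∈ S, ∀ g ∈ S, B f g = B' f g) {k : ℕ}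
    (hv : ∀ i ≤ k, v i ∈ S) : gramSchmidtFormNormed B v k = gramSchmidtFormNormed B' v k := by
  have hk : gramSchmidtForm B' v k ∈ S := gramSchmidtForm_mem B' hv
  rw [gramSchmidtFormNormed, gramSchmidtFormNormed, gramSchmidtForm_congr hB hv, hB _ hk _ hk]

variable {E F G : Type*} [NormedAddCommGroup E] [InnerProductSpace ℂ E]
  [NormedAddCommGroup F] [InnerProductSpace ℂ F] [NormedAddCommGroup G] [InnerProductSpace ℂ G]

/-- The inner product of `G` pulled back along `A`, linear in its first argument. -/
def pullbackForm (A : E →ₗ[ℂ] G) (f g : E) : ℂ :=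
  inner ℂ (A g) (A f)

lemma map_gramSchmidtForm_pullbackForm (A : E →ₗ[ℂ] G) (v : ℕ → E) (k : ℕ) :
    A (gramSchmidtForm (pullbackForm A) v k) = gramSchmidt ℂ (A ∘ v) k := by
  induction k using Nat.strong_induction_on with
  | _ k ih =>
    rw [gramSchmidtForm, gramSchmidt_def, map_sub, map_sum, Nat.Iio_eq_range, Finset.sum_range]
    congr 1
    refine Finset.sum_congr rfl fun i _ => ?_
    rw [map_smul, pullbackForm, pullbackForm, ih i i.isLt, Submodule.starProjection_singleton,
      inner_self_eq_norm_sq_to_K, Function.comp_apply]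
    norm_cast

lemma gramSchmidt_eq_gramSchmidtForm (v : ℕ → E) (k : ℕ) :
    gramSchmidt ℂ v k = gramSchmidtForm (pullbackForm .id) v k :=
  (map_gramSchmidtForm_pullbackForm .id v k).symm

lemma gramSchmidtFormNormed_pullbackForm (A : E →ₗ[ℂ] G) (v : ℕ → E) (k : ℕ) :
    gramSchmidtFormNormed (pullbackForm A) v k =
      (‖A (gramSchmidtForm (pullbackForm A) v k)‖ : ℂ)⁻¹ •
        gramSchmidtForm (pullbackForm A) v k := by
  rw [gramSchmidtFormNormed, pullbackForm, norm_eq_sqrt_re_inner (𝕜 := ℂ)]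
  rfl

lemma inner_map_gramSchmidtForm_eq_zero (A : E →ₗ[ℂ] G) {v : ℕ → E} {k : ℕ} {g : E}
    (hg : g ∈ Submodule.span ℂ (v '' Set.Iio k)) :
    inner ℂ (A g) (A (gramSchmidtForm (pullbackForm A) v k)) = 0 := by
  have hspan : Submodule.span ℂ (v '' Set.Iio k) ≤
      (LinearMap.ker (innerₛₗ ℂ (gramSchmidt ℂ (A ∘ v) k))).comap A := by
    rw [Submodule.span_le]
    rintro _ ⟨i, hi, rfl⟩
    exact gramSchmidt_inv_triangular ℂ (A ∘ v) hi
  rw [map_gramSchmidtForm_pullbackForm, inner_eq_zero_symm]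
  exact hspan hg

lemma norm_gramSchmidtFormNormed_sub_gramSchmidtNormed_le (T : E →L[ℂ] F) (v : ℕ → E) (k : ℕ) :
    ‖gramSchmidtFormNormed (pullbackForm (graphEmbedding T).toLinearMap) v k
      - gramSchmidtNormed ℂ v k‖ ≤ 2 * ‖T‖ ^ 2 := by
  set s := gramSchmidtForm (pullbackForm (graphEmbedding T).toLinearMap) v k
  set p := gramSchmidtForm (pullbackForm .id) v k
  have hspan : p - s ∈ Submodule.span ℂ (v '' Set.Iio k) := by
    rw [← sub_sub_sub_cancel_left _ _ (v k)]
    exact Submodule.sub_mem _ (sub_gramSchmidtForm_mem_span _ v k)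
      (sub_gramSchmidtForm_mem_span _ v k)
  have horth : inner ℂ (p - s) p = 0 := inner_map_gramSchmidtForm_eq_zero .id hspan
  have horth_graph : inner ℂ (graphEmbedding T (p - s)) (graphEmbedding T s) = 0 :=
    inner_map_gramSchmidtForm_eq_zero (graphEmbedding T).toLinearMap hspan
  have hdist : ‖s - p‖ ≤ ‖T‖ ^ 2 * ‖p‖ := by
    rw [norm_sub_rev]
    exact norm_le_opNorm_sq_mul_norm_of_orthogonal T horth (by rwa [sub_sub_cancel])
  have hlower : ‖p‖ ≤ ‖graphEmbedding T s‖ := by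
    have hsp : inner ℂ (s - p) p = 0 := by rw [← neg_sub, inner_neg_left, horth, neg_zero]
    calc ‖p‖ ≤ ‖s - p + p‖ := norm_le_norm_add_of_inner_eq_zero hsp
      _ = ‖s‖ := by rw [sub_add_cancel]
      _ ≤ ‖graphEmbedding T s‖ := norm_le_norm_graphEmbedding T s
  have hupper : ‖graphEmbedding T s‖ ≤ (1 + ‖T‖ ^ 2) * ‖p‖ :=
    calc ‖graphEmbedding T s‖ ≤ ‖graphEmbedding T (p - s) + graphEmbedding T s‖ :=
          norm_le_norm_add_of_inner_eq_zero horth_graph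
      _ = ‖graphEmbedding T p‖ := by rw [← map_add, sub_add_cancel]
      _ ≤ (1 + ‖T‖ ^ 2) * ‖p‖ := norm_graphEmbedding_le T p
  rw [gramSchmidtFormNormed_pullbackForm, gramSchmidtNormed, gramSchmidt_eq_gramSchmidtForm]
  exact norm_inv_smul_sub_inv_norm_smul_le (sq_nonneg _) hdist hlower hupper

end GramSchmidt

section WeightedCoefficients

variable {ι 𝕜 H : Type*} [RCLike 𝕜] [NormedAddCommGroup H] [InnerProductSpace 𝕜 H]

/-- The map `f ↦ (a i * ⟪v i, f⟫) i`. -/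
def weightedCoeff (v : ι → H) (a : ι → 𝕜) : H →L[𝕜] EuclideanSpace 𝕜 ι :=
  (EuclideanSpace.equiv ι 𝕜).symm.toContinuousLinearMap ∘L
    ContinuousLinearMap.pi fun i => a i • innerSL 𝕜 (v i)

lemma weightedCoeff_apply (v : ι → H) (a : ι → 𝕜) (f : H) (i : ι) :
    weightedCoeff v a f i = a i * inner 𝕜 (v i) f :=
  rfl

lemma norm_weightedCoeff_le [Fintype ι] {v : ι → H} (hv : Orthonormal 𝕜 v) {a : ι → 𝕜} {b : ℝ}
    (hb : 0 ≤ b) (ha : ∀ i, ‖a i‖ ≤ b) : ‖weightedCoeff v a‖ ≤ b := by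
  refine ContinuousLinearMap.opNorm_le_bound _ hb fun f => le_of_sq_le_sq ?_ (by positivity)
  calc ‖weightedCoeff v a f‖ ^ 2 = ∑ i, (‖a i‖ * ‖inner 𝕜 (v i) f‖) ^ 2 := by
        simp only [EuclideanSpace.norm_sq_eq, weightedCoeff_apply, norm_mul]
    _ ≤ ∑ i, (b * ‖inner 𝕜 (v i) f‖) ^ 2 := by
        gcongr
        exact ha _
    _ = b ^ 2 * ∑ i, ‖inner 𝕜 (v i) f‖ ^ 2 := by simp only [mul_pow, Finset.mul_sum]
    _ ≤ b ^ 2 * ‖f‖ ^ 2 := by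
        gcongr
        exact hv.sum_inner_products_le f
    _ = (b * ‖f‖) ^ 2 := (mul_pow b ‖f‖ 2).symm

end WeightedCoefficients

section CircleCalculus

lemma integral_haarAddCircle_eq_intervalIntegral {T : ℝ} [Fact (0 < T)] {E : Type*}
    [NormedAddCommGroup E] [NormedSpace ℝ E] (f : AddCircle T → E) (a : ℝ) :
    ∫ x, f x ∂haarAddCircle = T⁻¹ • ∫ t in a..a + T, f t := by
  rw [integral_haarAddCircle, AddCircle.intervalIntegral_preimage]

lemma hasSum_fourierCoeff_mul_conj {T : ℝ} [Fact (0 < T)] {f g : AddCircle T → ℂ}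
    (hf : MemLp f 2 haarAddCircle) (hg : MemLp g 2 haarAddCircle) :
    HasSum (fun n => fourierCoeff f n * conj (fourierCoeff g n))
      (∫ x, f x * conj (g x) ∂haarAddCircle) := by
  have hinner : inner ℂ (hg.toLp g) (hf.toLp f) = ∫ x, f x * conj (g x) ∂haarAddCircle := by
    rw [L2.inner_def]
    refine integral_congr_ae ?_
    filter_upwards [hf.coeFn_toLp, hg.coeFn_toLp] with x hfx hgx
    rw [hfx, hgx, RCLike.inner_apply]
  rw [← hinner]
  refine (fourierBasis.hasSum_inner_mul_inner (hg.toLp g) (hf.toLp f)).congr_fun fun n => ?_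
  rw [← inner_conj_symm, ← fourierBasis.repr_apply_apply, ← fourierBasis.repr_apply_apply,
    fourierBasis_repr, fourierBasis_repr, fourierCoeff_congr_ae hf.coeFn_toLp,
    fourierCoeff_congr_ae hg.coeFn_toLp, mul_comm]

lemma angleDeriv_coe (φ : S1 → ℂ) (t : ℝ) :
    angleDeriv φ (t : S1) = deriv (fun s : ℝ => φ (s : S1)) t := by
  simpa only [angleDeriv, add_zero, coe_add] using
    deriv_comp_const_add (fun s : ℝ => φ (s : S1)) t 0

namespace IsTestFunction

variable {φ : S1 → ℂ}

lemma hasDerivAt (hφ : IsTestFunction φ) (t : ℝ) :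
    HasDerivAt (fun s : ℝ => φ (s : S1)) (angleDeriv φ (t : S1)) t := by
  rw [angleDeriv_coe]
  exact (ContDiff.differentiable hφ (by simp) t).hasDerivAt

lemma continuous (hφ : IsTestFunction φ) : Continuous φ :=
  continuous_coinduced_dom.2 (ContDiff.continuous hφ)

lemma continuous_angleDeriv (hφ : IsTestFunction φ) : Continuous (angleDeriv φ) :=
  continuous_coinduced_dom.2 <|
    (ContDiff.continuous_deriv hφ (by simp)).congr fun t => (angleDeriv_coe φ t).symm

lemma hasWeakDeriv (hφ : IsTestFunction φ) : HasWeakDeriv φ (angleDeriv φ) := by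
  intro ψ hψ
  have hintegrable {χ : S1 → ℂ} (hχ : IsTestFunction χ) :
      IntervalIntegrable (fun t : ℝ => angleDeriv χ t) volume 0 (0 + 2 * Real.pi) :=
    (hχ.continuous_angleDeriv.comp (AddCircle.continuous_mk' _)).intervalIntegrable _ _
  rw [integral_haarAddCircle_eq_intervalIntegral _ 0,
    integral_haarAddCircle_eq_intervalIntegral _ 0,
    intervalIntegral.integral_mul_deriv_eq_deriv_mul (fun t _ => hφ.hasDerivAt t)
      (fun t _ => hψ.hasDerivAt t) (hintegrable hφ) (hintegrable hψ),
    coe_add_period, sub_self, zero_sub, smul_neg]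

lemma memH1 (hφ : IsTestFunction φ) : MemH1 φ :=
  ⟨hφ.continuous.memLp_of_hasCompactSupport (.of_compactSpace _), angleDeriv φ,
    hφ.continuous_angleDeriv.memLp_of_hasCompactSupport (.of_compactSpace _), hφ.hasWeakDeriv⟩

end IsTestFunction

lemma isTestFunction_fourier (n : ℤ) : IsTestFunction (fourier n : C(S1, ℂ)) := by
  simp only [IsTestFunction, fourier_coe_apply]
  exact ((contDiff_const.mul Complex.ofRealCLM.contDiff).div_const _).cexp

lemma angleDeriv_fourier (n : ℤ) (x : S1) :
    angleDeriv (fourier n : C(S1, ℂ)) x = Complex.I * n * fourier n x := by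
  induction x using QuotientAddGroup.induction_on with
  | H t =>
    refine (angleDeriv_coe _ t).trans ((hasDerivAt_fourier (2 * Real.pi) n t).deriv.trans ?_)
    have hpi : (Real.pi : ℂ) ≠ 0 := Complex.ofReal_ne_zero.2 Real.pi_ne_zero
    push_cast
    field_simp

variable {f f' g g' : S1 → ℂ}

lemma integrable_mul_of_continuous {φ : S1 → ℂ} (hf : Integrable f haarAddCircle)
    (hφ : Continuous φ) : Integrable (fun x => f x * φ x) haarAddCircle :=
  hf.mul_of_top_left (hφ.memLp_top_of_hasCompactSupport (.of_compactSpace _) _)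

namespace HasWeakDeriv

lemma congr (h : HasWeakDeriv f g) (hf : f =ᵐ[haarAddCircle] f')
    (hg : g =ᵐ[haarAddCircle] g') : HasWeakDeriv f' g' := by
  intro φ hφ
  calc ∫ x, f' x * angleDeriv φ x ∂haarAddCircle
      = ∫ x, f x * angleDeriv φ x ∂haarAddCircle := integral_congr_ae (hf.symm.mul .rfl)
    _ = -∫ x, g x * φ x ∂haarAddCircle := h φ hφ
    _ = -∫ x, g' x * φ x ∂haarAddCircle := congrArg Neg.neg (integral_congr_ae (hg.mul .rfl))

lemma add (h : HasWeakDeriv f g) (h' : HasWeakDeriv f' g') (hf : Integrable f haarAddCircle)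
    (hg : Integrable g haarAddCircle) (hf' : Integrable f' haarAddCircle)
    (hg' : Integrable g' haarAddCircle) : HasWeakDeriv (f + f') (g + g') := by
  intro φ hφ
  simp only [Pi.add_apply, add_mul]
  rw [integral_add (integrable_mul_of_continuous hf hφ.continuous_angleDeriv)
      (integrable_mul_of_continuous hf' hφ.continuous_angleDeriv),
    integral_add (integrable_mul_of_continuous hg hφ.continuous)
      (integrable_mul_of_continuous hg' hφ.continuous), h φ hφ, h' φ hφ, neg_add]

lemma const_smul (h : HasWeakDeriv f g) (c : ℂ) : HasWeakDeriv (c • f) (c • g) := by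
  intro φ hφ
  simp only [Pi.smul_apply, smul_eq_mul, mul_assoc, integral_const_mul]
  rw [h φ hφ, mul_neg]

lemma fourierCoeff_eq (h : HasWeakDeriv f g) (n : ℤ) :
    fourierCoeff g n = Complex.I * n * fourierCoeff f n := by
  have htest := h _ (isTestFunction_fourier (-n))
  simp only [angleDeriv_fourier] at htest
  calc fourierCoeff g n = ∫ x, g x * fourier (-n) x ∂haarAddCircle := by
        simp only [fourierCoeff, smul_eq_mul, mul_comm]
    _ = -∫ x, f x * (Complex.I * (-n : ℤ) * fourier (-n) x) ∂haarAddCircle := by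
        rw [htest, neg_neg]
    _ = ∫ x, Complex.I * n * (fourier (-n) x * f x) ∂haarAddCircle := by
        rw [← integral_neg]
        congr with x
        push_cast
        ring
    _ = Complex.I * n * fourierCoeff f n := by
        simp only [fourierCoeff, smul_eq_mul, integral_const_mul]

end HasWeakDeriv

namespace MemH1

lemma congr (h : MemH1 f) (hf : f =ᵐ[haarAddCircle] f') : MemH1 f' :=
  let ⟨hfL, g, hgL, hfg⟩ := h
  ⟨(memLp_congr_ae hf).1 hfL, g, hgL, hfg.congr hf .rfl⟩

lemma add (h : MemH1 f) (h' : MemH1 f') : MemH1 (f + f') :=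
  let ⟨hf, g, hg, hfg⟩ := h
  let ⟨hf', g', hg', hfg'⟩ := h'
  ⟨hf.add hf', g + g', hg.add hg', hfg.add hfg' (hf.integrable one_le_two)
    (hg.integrable one_le_two) (hf'.integrable one_le_two) (hg'.integrable one_le_two)⟩

lemma const_smul (h : MemH1 f) (c : ℂ) : MemH1 (c • f) :=
  let ⟨hf, g, hg, hfg⟩ := h
  ⟨hf.const_smul c, c • g, hg.const_smul c, hfg.const_smul c⟩

lemma memLp_weakDeriv (h : MemH1 f) : MemLp (weakDeriv f) 2 haarAddCircle := by
  rw [weakDeriv, dif_pos h]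
  exact h.2.choose_spec.1

lemma hasWeakDeriv_weakDeriv (h : MemH1 f) : HasWeakDeriv f (weakDeriv f) := by
  rw [weakDeriv, dif_pos h]
  exact h.2.choose_spec.2

end MemH1

end CircleCalculus

section DominatingMeasure

/-- The canonical map `Lᵖ(ν) → Lᵖ(μ)` for `μ ≤ c • ν`. It is Mathlib's `LpToLpOfMeasureLeSMul` with
scalars `𝕜` in place of `ℝ`. -/
def lpOfMeasureLeSMul {α E : Type*} (𝕜 : Type*) [MeasurableSpace α] {μ ν : Measure α}
    [NormedAddCommGroup E] [NormedSpace ℝ E] [NormedField 𝕜] [NormedSpace 𝕜 E] {p c : ENNReal}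
    [Fact (1 ≤ p)] (hc : c ≠ ⊤) (h : μ ≤ c • ν) : Lp E p ν →L[𝕜] Lp E p μ where
  toFun := Lp.LpToLpOfMeasureLeSMul hc h
  map_add' := map_add _
  map_smul' a f := by
    have hac : μ ≪ ν := Measure.absolutelyContinuous_of_le_smul h
    ext1
    filter_upwards [Lp.coeFn_LpToLpOfMeasureLeSMul hc h (a • f), hac.ae_eq (Lp.coeFn_smul a f),
      Lp.coeFn_smul a (Lp.LpToLpOfMeasureLeSMul hc h f),
      Lp.coeFn_LpToLpOfMeasureLeSMul hc h f] with x h₁ h₂ h₃ h₄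
    rw [h₁, h₂, RingHom.id_apply, h₃, Pi.smul_apply, Pi.smul_apply, h₄]
  cont := (Lp.LpToLpOfMeasureLeSMul hc h).continuous

lemma coeFn_lpOfMeasureLeSMul {α E 𝕜 : Type*} [MeasurableSpace α] {μ ν : Measure α}
    [NormedAddCommGroup E] [NormedSpace ℝ E] [NormedField 𝕜] [NormedSpace 𝕜 E] {p c : ENNReal}
    [Fact (1 ≤ p)] (hc : c ≠ ⊤) (h : μ ≤ c • ν) (f : Lp E p ν) :
    lpOfMeasureLeSMul 𝕜 hc h f =ᵐ[μ] f :=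
  Lp.coeFn_LpToLpOfMeasureLeSMul hc h f

lemma norm_lpOfMeasureLeSMul_le {α E 𝕜 : Type*} [MeasurableSpace α] {μ ν : Measure α}
    [NormedAddCommGroup E] [NormedSpace ℝ E] [NontriviallyNormedField 𝕜] [NormedSpace 𝕜 E]
    {p c : ENNReal} [Fact (1 ≤ p)] (hc : c ≠ ⊤) (h : μ ≤ c • ν) :
    ‖(lpOfMeasureLeSMul 𝕜 hc h : Lp E p ν →L[𝕜] Lp E p μ)‖ ≤ c.toReal ^ (1 / p).toReal := by
  have hreal : ‖(Lp.LpToLpOfMeasureLeSMul hc h : Lp E p ν →L[ℝ] Lp E p μ)‖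
      ≤ c.toReal ^ (1 / p).toReal := Lp.norm_LpToLpOfMeasureLeSMul_le hc h
  exact ContinuousLinearMap.opNorm_le_bound _ (Real.rpow_nonneg ENNReal.toReal_nonneg _) fun f =>
    ContinuousLinearMap.le_of_opNorm_le _ hreal f

lemma inner_fourierLp_lpOfMeasureLeSMul {T : ℝ} [Fact (0 < T)] {μ : Measure (AddCircle T)}
    {c : ENNReal} (hc : c ≠ ⊤) (hμ : haarAddCircle ≤ c • μ) (n : ℤ) (f : Lp ℂ 2 μ) :
    inner ℂ (fourierLp 2 n) (lpOfMeasureLeSMul ℂ hc hμ f) = fourierCoeff f n := by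
  rw [← fourierCoeff_congr_ae (coeFn_lpOfMeasureLeSMul (𝕜 := ℂ) hc hμ f), ← fourierBasis_repr,
    fourierBasis.repr_apply_apply, coe_fourierBasis]

variable {μ : Measure S1} {c : ENNReal}

/-- The map `f ↦ √λ f'` on `L²(μ)`, truncated to the Fourier coefficients of frequency at most `N`;
the truncation makes it a bounded operator. -/
def truncatedDeriv (hc : c ≠ ⊤) (hμ : haarAddCircle ≤ c • μ) (N : ℕ) (lam : ℝ) :
    Lp ℂ 2 μ →L[ℂ] EuclideanSpace ℂ (Finset.Icc (-N : ℤ) N) :=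
  weightedCoeff (fun n => fourierLp 2 (n : ℤ)) (fun n => √lam * (Complex.I * (n : ℤ))) ∘L
    lpOfMeasureLeSMul ℂ hc hμ

lemma truncatedDeriv_apply (hc : c ≠ ⊤) (hμ : haarAddCircle ≤ c • μ) (N : ℕ) (lam : ℝ)
    {f : Lp ℂ 2 μ} (hf : MemH1 f) (n : Finset.Icc (-N : ℤ) N) :
    truncatedDeriv hc hμ N lam f n = √lam * fourierCoeff (weakDeriv f) n := by
  rw [truncatedDeriv, ContinuousLinearMap.comp_apply, weightedCoeff_apply,
    inner_fourierLp_lpOfMeasureLeSMul, hf.hasWeakDeriv_weakDeriv.fourierCoeff_eq, mul_assoc]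

lemma norm_truncatedDeriv_sq_le (hc : c ≠ ⊤) (hμ : haarAddCircle ≤ c • μ) (N : ℕ) {lam : ℝ}
    (hlam : 0 ≤ lam) : ‖truncatedDeriv hc hμ N lam‖ ^ 2 ≤ c.toReal * N ^ 2 * lam := by
  have hcoeff (n : Finset.Icc (-N : ℤ) N) : ‖(√lam : ℂ) * (Complex.I * (n : ℤ))‖ ≤ √lam * N := by
    have hn : |(n : ℤ)| ≤ N := abs_le.2 (Finset.mem_Icc.1 n.2)
    rw [norm_mul, norm_mul, Complex.norm_I, one_mul, Complex.norm_real, Real.norm_eq_abs,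
      abs_of_nonneg (Real.sqrt_nonneg lam), Complex.norm_intCast]
    gcongr
    exact_mod_cast hn
  calc ‖truncatedDeriv hc hμ N lam‖ ^ 2 ≤ (√lam * N * c.toReal ^ (1 / 2 : ENNReal).toReal) ^ 2 := by
        refine pow_le_pow_left₀ (norm_nonneg _)
          ((ContinuousLinearMap.opNorm_comp_le _ _).trans ?_) 2
        exact mul_le_mul
          (norm_weightedCoeff_le (orthonormal_fourier.comp _ Subtype.val_injective)
            (by positivity) hcoeff) (norm_lpOfMeasureLeSMul_le hc hμ) (norm_nonneg _)
          (by positivity)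
    _ = √lam ^ 2 * N ^ 2 * √c.toReal ^ 2 := by
        rw [mul_pow, mul_pow, Real.sqrt_eq_rpow c.toReal, one_div, ENNReal.toReal_inv,
          ENNReal.toReal_ofNat, one_div]
    _ = c.toReal * N ^ 2 * lam := by
        rw [Real.sq_sqrt hlam, Real.sq_sqrt ENNReal.toReal_nonneg]
        ring

/-- The space `H¹(S¹)` as a subspace of `L²(μ)`. -/
def h1Submodule (hμ : haarAddCircle ≪ μ) : Submodule ℂ (Lp ℂ 2 μ) where
  carrier := {f | MemH1 f}
  add_mem' {f g} hf hg := (MemH1.add hf hg).congr (hμ.ae_eq (Lp.coeFn_add f g).symm)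
  zero_mem' := MemH1.congr (f := 0)
    (by simpa only [zero_smul] using (isTestFunction_fourier 0).memH1.const_smul 0)
    (hμ.ae_eq (Lp.coeFn_zero ℂ 2 μ).symm)
  smul_mem' a f hf := (MemH1.const_smul hf a).congr (hμ.ae_eq (Lp.coeFn_smul a f).symm)

variable [IsFiniteMeasure μ]

lemma toLp_fourier_mem_h1Submodule (hμ : haarAddCircle ≪ μ) (n : ℤ) :
    ContinuousMap.toLp 2 μ ℂ (fourier n) ∈ h1Submodule hμ :=
  (isTestFunction_fourier n).memH1.congr (hμ.ae_eq (ContinuousMap.coeFn_toLp μ _).symm)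

lemma dense_h1Submodule (hμ : haarAddCircle ≪ μ) : Dense (h1Submodule hμ : Set (Lp ℂ 2 μ)) := by
  have hdense := (ContinuousMap.toLp_denseRange ℂ μ ℂ (p := 2)
    (by simp)).topologicalClosure_map_submodule (span_fourier_closure_eq_top (T := 2 * Real.pi))
  rw [Submodule.dense_iff_topologicalClosure_eq_top, eq_top_iff, ← hdense]
  refine Submodule.topologicalClosure_mono ?_
  rw [Submodule.map_span, Submodule.span_le]
  rintro _ ⟨_, ⟨n, rfl⟩, rfl⟩
  exact toLp_fourier_mem_h1Submodule hμ n

variable (μ) in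
/-- The trigonometric polynomials of degree at most `N`, as a subspace of `L²(μ)`. -/
def trigPolynomials (N : ℕ) : Submodule ℂ (Lp ℂ 2 μ) :=
  Submodule.span ℂ ((fun n : ℤ => ContinuousMap.toLp 2 μ ℂ (fourier n)) '' Set.Icc (-N) N)

lemma trigPolynomials_le_h1Submodule (hμ : haarAddCircle ≪ μ) (N : ℕ) :
    trigPolynomials μ N ≤ h1Submodule hμ := by
  refine Submodule.span_le.2 ?_
  rintro _ ⟨n, -, rfl⟩
  exact toLp_fourier_mem_h1Submodule hμ n

lemma fourierCoeff_eq_zero_of_mem_trigPolynomials (hc : c ≠ ⊤) (hμ : haarAddCircle ≤ c • μ)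
    {N : ℕ} {f : Lp ℂ 2 μ} (hf : f ∈ trigPolynomials μ N) {n : ℤ} (hn : n ∉ Set.Icc (-N : ℤ) N) :
    fourierCoeff f n = 0 := by
  have hspan : trigPolynomials μ N ≤
      LinearMap.ker (innerSL ℂ (fourierLp 2 n) ∘L lpOfMeasureLeSMul ℂ hc hμ).toLinearMap := by
    refine Submodule.span_le.2 ?_
    rintro _ ⟨m, hm, rfl⟩
    have hac : haarAddCircle ≪ μ := Measure.absolutelyContinuous_of_le_smul hμ
    refine (inner_fourierLp_lpOfMeasureLeSMul hc hμ n _).trans ?_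
    rw [fourierCoeff_congr_ae (hac.ae_eq (ContinuousMap.coeFn_toLp μ (fourier m))),
      fourierCoeff_fourier, Pi.single_eq_of_ne]
    rintro rfl
    exact hn hm
  rw [← inner_fourierLp_lpOfMeasureLeSMul hc hμ]
  exact hspan hf

lemma inner_truncatedDeriv (hc : c ≠ ⊤) (hμ : haarAddCircle ≤ c • μ) {N : ℕ} {lam : ℝ}
    (hlam : 0 ≤ lam) {f g : Lp ℂ 2 μ} (hf : MemH1 f) (hg : g ∈ trigPolynomials μ N) :
    inner ℂ (truncatedDeriv hc hμ N lam g) (truncatedDeriv hc hμ N lam f) =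
      lam * ∫ x, weakDeriv f x * conj (weakDeriv g x) ∂haarAddCircle := by
  have hg₁ : MemH1 g :=
    trigPolynomials_le_h1Submodule (Measure.absolutelyContinuous_of_le_smul hμ) N hg
  have hvanish : ∀ n ∉ Finset.Icc (-N : ℤ) N,
      fourierCoeff (weakDeriv f) n * conj (fourierCoeff (weakDeriv g) n) = 0 := by
    intro n hn
    rw [hg₁.hasWeakDeriv_weakDeriv.fourierCoeff_eq, fourierCoeff_eq_zero_of_mem_trigPolynomials
      hc hμ hg (by rwa [← Finset.coe_Icc]), mul_zero, map_zero, mul_zero]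
  have hsqrt : (√lam : ℂ) * √lam = lam := by rw [← Complex.ofReal_mul, Real.mul_self_sqrt hlam]
  rw [(hasSum_fourierCoeff_mul_conj hf.memLp_weakDeriv hg₁.memLp_weakDeriv).unique
      (hasSum_sum_of_ne_finset_zero hvanish), ← Finset.sum_coe_sort, Finset.mul_sum,
    PiLp.inner_apply]
  refine Finset.sum_congr rfl fun n _ => ?_
  rw [RCLike.inner_apply, truncatedDeriv_apply hc hμ N lam hf, truncatedDeriv_apply hc hμ N lam hg₁,
    map_mul, Complex.conj_ofReal, mul_mul_mul_comm, hsqrt]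

variable (μ) in
/-- The Sobolev form `⟨f, g⟩_μ + λ ∫ f' * conj g' dθ / 2π`, meaningful for `f` and `g` in
`H¹(S¹)`. -/
def sobolevForm (lam : ℝ) (f g : Lp ℂ 2 μ) : ℂ :=
  inner ℂ g f + lam * ∫ x, weakDeriv f x * conj (weakDeriv g x) ∂haarAddCircle

lemma sobolevForm_eq_pullbackForm (hc : c ≠ ⊤) (hμ : haarAddCircle ≤ c • μ) {N : ℕ} {lam : ℝ}
    (hlam : 0 ≤ lam) {f g : Lp ℂ 2 μ} (hf : MemH1 f) (hg : g ∈ trigPolynomials μ N) :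
    sobolevForm μ lam f g =
      pullbackForm (graphEmbedding (truncatedDeriv hc hμ N lam)).toLinearMap f g := by
  rw [sobolevForm, ← inner_truncatedDeriv hc hμ hlam hf hg]
  exact (inner_graphEmbedding _ g f).symm

variable (μ) in
/-- `P` is the projection of `L²(μ)` onto `V` that is orthogonal for the Sobolev form; only
functions in `H¹(S¹)` are tested. -/
def IsSobolevProjection (lam : ℝ) (V : Submodule ℂ (Lp ℂ 2 μ)) (P : Lp ℂ 2 μ →L[ℂ] Lp ℂ 2 μ) :
    Prop :=
  (∀ f, P f ∈ V) ∧ ∀ f : Lp ℂ 2 μ, MemH1 f → ∀ g ∈ V, sobolevForm μ lam (f - P f) g = 0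

lemma isSobolevProjection_iff (hc : c ≠ ⊤) (hμ : haarAddCircle ≤ c • μ) {N : ℕ} {lam : ℝ}
    (hlam : 0 ≤ lam) {V : Submodule ℂ (Lp ℂ 2 μ)} [FiniteDimensional ℂ V]
    (hV : V ≤ trigPolynomials μ N) {P : Lp ℂ 2 μ →L[ℂ] Lp ℂ 2 μ} :
    IsSobolevProjection μ lam V P ↔ P = pullbackProjection
      (graphEmbedding (truncatedDeriv hc hμ N lam)) (graphEmbedding_injective _) V := by
  have hac : haarAddCircle ≪ μ := Measure.absolutelyContinuous_of_le_smul hμ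
  have hform {f g : Lp ℂ 2 μ} (hP : ∀ f, P f ∈ V) (hf : MemH1 f) (hg : g ∈ V) :
      sobolevForm μ lam (f - P f) g = inner ℂ (graphEmbedding (truncatedDeriv hc hμ N lam) g)
        (graphEmbedding (truncatedDeriv hc hμ N lam) (f - P f)) :=
    sobolevForm_eq_pullbackForm hc hμ hlam ((h1Submodule hac).sub_mem hf
      (trigPolynomials_le_h1Submodule hac N (hV (hP f)))) (hV hg)
  constructor
  · rintro ⟨hmem, horth⟩
    refine ContinuousLinearMap.coeFn_injective <|
      P.continuous.ext_on (dense_h1Submodule hac) (ContinuousLinearMap.continuous _) fun f hf => ?_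
    exact (eq_pullbackProjection_iff _ _ V).2
      ⟨hmem f, fun g hg => (hform hmem hf hg).symm.trans (horth f hf g hg)⟩
  · intro hP
    have hiff (f : Lp ℂ 2 μ) := (eq_pullbackProjection_iff _ _ V).1 (DFunLike.congr_fun hP f)
    have hmem (f : Lp ℂ 2 μ) : P f ∈ V := (hiff f).1
    exact ⟨hmem, fun f hf g hg => (hform hmem hf hg).trans ((hiff f).2 g hg)⟩

end DominatingMeasure

namespace Weight

variable (W : Weight)

lemma haarAddCircle_le_smul_measure :
    (haarAddCircle : Measure S1) ≤ ENNReal.ofReal W.lower⁻¹ • W.measure := by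
  have hlow := W.lower_pos
  rw [measure, ← withDensity_smul' _ _ ENNReal.ofReal_ne_top]
  conv_lhs => rw [← withDensity_one (μ := (haarAddCircle : Measure S1))]
  refine withDensity_mono ?_
  filter_upwards [W.lower_le] with x hx
  rw [Pi.one_apply, Pi.smul_apply, smul_eq_mul, ← ENNReal.ofReal_mul (inv_nonneg.2 hlow.le),
    ENNReal.one_le_ofReal, le_inv_mul_iff₀ hlow, mul_one]
  exact hx

lemma upper_pos : 0 < W.upper :=
  let ⟨_, hlower, hupper⟩ := (W.lower_le.and W.le_upper).exists
  W.lower_pos.trans_le (hlower.trans hupper)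

lemma sobolevInner_eq_sobolevForm (lam : ℝ) : sobolevInner W lam = sobolevForm W.measure lam := by
  ext f g
  rw [sobolevInner, sobolevForm, L2.inner_def]
  congr 1
  refine Eq.trans (integral_congr_ae ?_) (integral_withDensity_eq_integral_toReal_smul₀
    W.memW1Inf.1.1.aemeasurable.ennreal_ofReal (by simp) _).symm
  filter_upwards [W.lower_le] with x hx
  rw [ENNReal.toReal_ofReal (W.lower_pos.le.trans hx), RCLike.inner_apply, Complex.real_smul,
    mul_comm]

lemma monomial_mem_analyticModes {k N : ℕ} (hk : k ≤ N) : monomial W k ∈ analyticModes W N :=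
  Submodule.subset_span ⟨k, hk, rfl⟩

lemma analyticModes_le_trigPolynomials (N : ℕ) :
    analyticModes W N ≤ trigPolynomials W.measure N := by
  refine Submodule.span_mono ?_
  rintro _ ⟨k, hk, rfl⟩
  exact ⟨k, ⟨by lia, Int.ofNat_le.2 hk⟩, rfl⟩

lemma isSobolevProjector_iff (lam : ℝ) (N : ℕ) (P : L2 W →L[ℂ] L2 W) :
    IsSobolevProjector W lam N P ↔ IsSobolevProjection W.measure lam (analyticModes W N) P := by
  rw [IsSobolevProjector, IsSobolevProjection, sobolevInner_eq_sobolevForm]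

lemma sq_div_lower_le_finiteDegreeConst (N : ℕ) :
    (N : ℝ) ^ 2 / W.lower ≤ finiteDegreeConst W N := by
  have hlow := W.lower_pos
  have hup := W.upper_pos
  have hpow : (N : ℝ) ^ 2 ≤ (N : ℝ) ^ 4 := by
    exact_mod_cast (Nat.le_self_pow two_ne_zero (N ^ 2)).trans_eq (pow_mul N 2 2).symm
  calc (N : ℝ) ^ 2 / W.lower = (N : ℝ) ^ 2 * (1 / W.lower) := div_eq_mul_one_div _ _
    _ ≤ (N : ℝ) ^ 4 * (W.upper / W.lower ^ 2 + 1 / W.lower) := by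
        gcongr
        exact le_add_of_nonneg_left (by positivity)

end Weight

end SobolevOPUC

end

open SobolevOPUC InnerProductSpace in
theorem mainTheorem5_general {μ : Measure S1} [IsFiniteMeasure μ] {c : ENNReal} (hc : c ≠ ⊤)
    (hμ : haarAddCircle ≤ c • μ) {N : ℕ} {V : Submodule ℂ (Lp ℂ 2 μ)} [FiniteDimensional ℂ V]
    (hV : V ≤ trigPolynomials μ N) {lam : ℝ} (hlam : 0 ≤ lam) :
    (∃ P : Lp ℂ 2 μ →L[ℂ] Lp ℂ 2 μ,
      IsSobolevProjection μ lam V P ∧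
      (∀ Q : Lp ℂ 2 μ →L[ℂ] Lp ℂ 2 μ, IsSobolevProjection μ lam V Q → Q = P) ∧
      ‖P - V.starProjection‖ ≤ c.toReal * N ^ 2 * lam) ∧
    ∀ (v : ℕ → Lp ℂ 2 μ) (k : ℕ), (∀ i ≤ k, v i ∈ V) →
      ‖gramSchmidtFormNormed (sobolevForm μ lam) v k - gramSchmidtNormed ℂ v k‖
        ≤ 2 * (c.toReal * N ^ 2 * lam) := by
  have hT := norm_truncatedDeriv_sq_le hc hμ N hlam
  constructor
  · refine ⟨_, (isSobolevProjection_iff hc hμ hlam hV).2 rfl,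
      fun Q => (isSobolevProjection_iff hc hμ hlam hV).1, ?_⟩
    exact (norm_pullbackProjection_graphEmbedding_sub_starProjection_le _ V).trans hT
  · intro v k hv
    have hH1 := trigPolynomials_le_h1Submodule (Measure.absolutelyContinuous_of_le_smul hμ) N
    rw [gramSchmidtFormNormed_congr (fun f hf g hg => sobolevForm_eq_pullbackForm hc hμ hlam
      (hH1 (hV hf)) (hV hg)) hv]
    exact (norm_gramSchmidtFormNormed_sub_gramSchmidtNormed_le _ v k).trans (by gcongr)

open SobolevOPUC in
theorem mainTheorem5 :
    ∃ K : ℝ, 0 < K ∧ ∀ (W : Weight) (N : ℕ),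
      ∃ C : ℝ, 0 ≤ C ∧ (1 ≤ N → 0 < C) ∧ C ≤ K * finiteDegreeConst W N ∧
        (∀ lam : ℝ, 0 < lam →
          ∃ P : L2 W →L[ℂ] L2 W,
            IsSobolevProjector W lam N P ∧
            (∀ Q : L2 W →L[ℂ] L2 W, IsSobolevProjector W lam N Q → Q = P) ∧
            ‖P - (analyticModes W N).starProjection‖ ≤ C * lam) ∧
        ∃ U : Matrix.unitaryGroup (Fin (N + 1)) ℂ,
          ∀ lam : ℝ, 0 < lam → ∀ k : Fin (N + 1),
            ‖sobolevOpuc W lam k - ∑ j : Fin (N + 1), (U : Matrix _ _ ℂ) k j • opuc W j‖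
              ≤ C * lam := by
  refine ⟨2, two_pos, fun W N => ⟨2 * (N ^ 2 / W.lower), ?_⟩⟩
  have hlow := W.lower_pos
  have hmain (lam : ℝ) (hlam : 0 < lam) := mainTheorem5_general ENNReal.ofReal_ne_top
    W.haarAddCircle_le_smul_measure (W.analyticModes_le_trigPolynomials N) hlam.le
  have hC (lam : ℝ) : (ENNReal.ofReal W.lower⁻¹).toReal * N ^ 2 * lam = N ^ 2 / W.lower * lam := by
    rw [ENNReal.toReal_ofReal (by positivity), inv_mul_eq_div]
  simp only [hC, ← W.isSobolevProjector_iff] at hmain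
  refine ⟨by positivity, fun hN => by positivity,
    mul_le_mul_of_nonneg_left (W.sq_div_lower_le_finiteDegreeConst N) zero_le_two,
    fun lam hlam => ?_, 1, fun lam hlam k => ?_⟩
  · obtain ⟨P, hP, huniq, hnorm⟩ := (hmain lam hlam).1
    refine ⟨P, hP, huniq, hnorm.trans ?_⟩
    rw [mul_assoc]
    exact le_mul_of_one_le_left (by positivity) one_le_two
  · have hk := (hmain lam hlam).2 (monomial W) k fun i hi =>
      W.monomial_mem_analyticModes (hi.trans (Nat.lt_succ_iff.1 k.2))
    simpa [sobolevOpuc, opuc, W.sobolevInner_eq_sobolevForm, Matrix.one_apply, mul_assoc] using hk
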